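/- Let $K$ be a field with $\operatorname{char} K \neq 3$, let $G$ and $H$ be unital associative $K$-algebras, and let $p \geq 2$ be an integer. Left-normed commutators are defined by $[u_1,u_2]=u_1u_2-u_2u_1$ and $[u_1,\dots,u_{n+1}]=[[u_1,\dots,u_n],u_{n+1}]$ for $n\ge 2$. An algebra $A$ satisfies the identity $f(x_1,\dots,x_m)=0$, where $f$ is an element of the free unital associative $K$-algebra on $x_1,x_2,\dots$, if $f(a_1,\dots,a_m)=0$ for all $a_1,\dots,a_m\in A$. Suppose that $G$ satisfies the identity $[x_1,\dots,x_p]=0$ and that $H$ satisfies the identities $[x_1,x_2,x_3]=0$ and $[x_1,x_2][x_3,x_4]=0$. Then: (i) if $p$ is even, then $G\otimes_K H$ satisfies the identity $[x_1,\dots,x_{p+1}]=0$; (ii) if $p$ is odd, then $G\otimes_K H$ satisfies the identity $[x_1,\dots,x_{p+2}]=0$. -/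

import Mathlib

open scoped TensorProduct

/-- The left-normed commutator `[u₁, …, uₙ]` of length `n` of the elements `u₁, u₂, …` of a ring:
`[u₁, u₂] = u₁ u₂ - u₂ u₁` and `[u₁, …, uₙ₊₁] = [[u₁, …, uₙ], uₙ₊₁]`, with the convention
`[u₁] = u₁`. The entry `u 0` is not used, and the value at length `0` is a dummy value. -/
def longCommutator {R : Type*} [Ring R] (u : ℕ → R) : ℕ → R
  | 0 => 0
  | 1 => u 1
  | n + 2 => longCommutator u (n + 1) * u (n + 2) - u (n + 2) * longCommutator u (n + 1)

/-- The `K`-algebra `A` satisfies the polynomial identity `f = 0`, where `f` is an element of the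
free unital associative algebra `K⟨X⟩` on countably many variables `xᵢ = FreeAlgebra.ι K i`:
every substitution of elements of `A` for the variables sends `f` to zero. -/
def SatisfiesIdentity (K : Type*) [Field K] (A : Type*) [Ring A] [Algebra K A]
    (f : FreeAlgebra K ℕ) : Prop :=
  ∀ a : ℕ → A, FreeAlgebra.lift K a f = 0

/-! Fix an algebra over `K` with `3 ≠ 0`. If `I` is the ideal generated by commutators of odd length
`l`, then `[I, A]` lies in the span of commutators of length `l + 1`. Induction on `l` in steps of
two gives this, through an identity that forces division by 3. Hence a product of commutators of
lengths `l` and `m`, one of them odd, lies in the ideal of length `l + m - 1`.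

In `G ⊗ H` the elements `[h₁, h₂] h₃` are central in `H`, so a commutator of length `p + 1` is a sum
of tensors `a ⊗ h` and `ab ⊗ [h₁, h₂] h₃`, where `a`, respectively `a` and `b` together, have length
`p + 1`. For even `p` one of `a`, `b` has odd length, so `ab` lies in the ideal of length `p`, which
is zero. Odd `p` reduces to `p + 1`. -/

section LocalLieRing

attribute [local instance] LieRing.ofAssociativeRing

/-- The linear map `a ↦ [a, x]` on an associative algebra. -/
def commutatorRight (K : Type*) [Field K] {A : Type*} [Ring A] [Algebra K A] (x : A) : A →ₗ[K] A :=
  LinearMap.mulRight K x - LinearMap.mulLeft K x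

theorem commutatorRight_apply {K : Type*} [Field K] {A : Type*} [Ring A] [Algebra K A] (x a : A) :
    commutatorRight K x a = ⁅a, x⁆ := rfl

/-! ### Commutator spans, the ideals they generate, and products of commutators -/

section LowerCentral

variable (K : Type*) [Field K] (A : Type*) [Ring A] [Algebra K A]

/-- The span of the left-normed commutators of length `n + 1` of an associative algebra. -/
def commutatorSpan : ℕ → Submodule K A
  | 0 => ⊤
  | n + 1 => Submodule.span K {z | ∃ a ∈ commutatorSpan n, ∃ x : A, z = ⁅a, x⁆}

/-- The ideal generated by the left-normed commutators of length `n + 1`. -/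
def commutatorIdeal (n : ℕ) : Submodule K A :=
  Submodule.span K {z | ∃ x : A, ∃ a ∈ commutatorSpan K A n, z = x * a}

variable {K A}

theorem mem_commutatorSpan_zero (a : A) : a ∈ commutatorSpan K A 0 := trivial

theorem lie_mem_commutatorSpan {n : ℕ} {a : A} (ha : a ∈ commutatorSpan K A n) (x : A) :
    ⁅a, x⁆ ∈ commutatorSpan K A (n + 1) :=
  Submodule.subset_span ⟨a, ha, x, rfl⟩

theorem commutatorSpan_succ_induction {n : ℕ} {P : Submodule K A}
    (h : ∀ a ∈ commutatorSpan K A n, ∀ x : A, ⁅a, x⁆ ∈ P) :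
    commutatorSpan K A (n + 1) ≤ P := by
  refine Submodule.span_le.2 ?_
  rintro _ ⟨a, ha, x, rfl⟩
  exact h a ha x

theorem commutatorSpan_succ_le (n : ℕ) : commutatorSpan K A (n + 1) ≤ commutatorSpan K A n := by
  induction n with
  | zero => exact le_top
  | succ n ih => exact commutatorSpan_succ_induction fun a ha x => lie_mem_commutatorSpan (ih ha) x

theorem lie_mem_commutatorSpan_add (k : ℕ) : ∀ {n : ℕ} {a w : A}, a ∈ commutatorSpan K A n →
    w ∈ commutatorSpan K A k → ⁅a, w⁆ ∈ commutatorSpan K A (n + k + 1) := by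
  induction k with
  | zero => exact fun ha _ => lie_mem_commutatorSpan ha _
  | succ k ih =>
    intro n a w ha hw
    suffices commutatorSpan K A (k + 1) ≤
        (commutatorSpan K A (n + (k + 1) + 1)).comap (commutatorRight K a) by
      rw [← lie_skew]
      exact neg_mem (this hw)
    refine commutatorSpan_succ_induction fun w hw y => ?_
    have e : ⁅⁅w, y⁆, a⁆ = ⁅⁅a, y⁆, w⁆ - ⁅⁅a, w⁆, y⁆ := by
      simp only [Ring.lie_def]; noncomm_ring
    rw [Submodule.mem_comap, commutatorRight_apply, e]
    refine sub_mem ?_ (lie_mem_commutatorSpan (ih ha hw) y)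
    have := ih (lie_mem_commutatorSpan ha y) hw
    rwa [show n + 1 + k + 1 = n + (k + 1) + 1 by ring] at this

/-- If bracketing with `m` maps `A` into the commutators of length `n + 2`, then it raises
commutator length by `n + 1`. -/
theorem lie_mem_commutatorSpan_add_of_forall {m : A} {n : ℕ}
    (hm : ∀ y : A, ⁅m, y⁆ ∈ commutatorSpan K A (n + 1)) (k : ℕ) :
    ∀ w ∈ commutatorSpan K A k, ⁅m, w⁆ ∈ commutatorSpan K A (n + k + 1) := by
  induction k with
  | zero => exact fun w _ => hm w
  | succ k ih =>
    intro w hw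
    suffices commutatorSpan K A (k + 1) ≤
        (commutatorSpan K A (n + (k + 1) + 1)).comap (commutatorRight K m) by
      rw [← lie_skew]
      exact neg_mem (this hw)
    refine commutatorSpan_succ_induction fun w hw y => ?_
    have e : ⁅⁅w, y⁆, m⁆ = ⁅⁅m, y⁆, w⁆ - ⁅⁅m, w⁆, y⁆ := by
      simp only [Ring.lie_def]; noncomm_ring
    rw [Submodule.mem_comap, commutatorRight_apply, e]
    refine sub_mem ?_ (lie_mem_commutatorSpan (ih w hw) y)
    have := lie_mem_commutatorSpan_add k (hm y) hw
    rwa [show n + 1 + k + 1 = n + (k + 1) + 1 by ring] at this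

theorem mul_left_mem_commutatorIdeal {n : ℕ} {a : A} (ha : a ∈ commutatorSpan K A n) (x : A) :
    x * a ∈ commutatorIdeal K A n :=
  Submodule.subset_span ⟨x, a, ha, rfl⟩

theorem commutatorSpan_le_commutatorIdeal (n : ℕ) :
    commutatorSpan K A n ≤ commutatorIdeal K A n := fun a ha => by
  simpa using mul_left_mem_commutatorIdeal ha 1

/-- Left multiples absorb right ones, since `[a, x]` is again in the span. -/
theorem mul_right_mem_commutatorIdeal {n : ℕ} {a : A} (ha : a ∈ commutatorSpan K A n) (x : A) :
    a * x ∈ commutatorIdeal K A n := by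
  have e : a * x = x * a + ⁅a, x⁆ := by rw [Ring.lie_def]; abel
  rw [e]
  exact add_mem (mul_left_mem_commutatorIdeal ha x) (commutatorSpan_le_commutatorIdeal n
    (commutatorSpan_succ_le n (lie_mem_commutatorSpan ha x)))

/-- On the right every term is a fourfold commutator in which `a` is an entry or a factor of one.
For `a` of length `n + 1` that entry lies in `commutatorIdeal K A n`, where the induction hypothesis
applies. -/
theorem three_nsmul_lie_mul_lie_lie (a b c x y : A) :
    3 • ⁅x * ⁅⁅a, b⁆, c⁆, y⁆ =
      2 • ⁅⁅⁅a, b⁆, x * c⁆, y⁆ + ⁅⁅⁅b * x, c⁆, a⁆, y⁆ + ⁅⁅⁅b, a⁆, x⁆, c * y⁆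
      + ⁅⁅⁅c, x⁆, a⁆, y * b⁆ + ⁅⁅⁅y, x⁆, b⁆, a * c⁆ + ⁅⁅⁅x, y⁆, c * b⁆, a⁆
      + ⁅⁅⁅c, y⁆, b⁆, a * x⁆ + ⁅⁅⁅b * c, y⁆, a⁆, x⁆ + ⁅⁅⁅y, a⁆, b * x⁆, c⁆
      + ⁅⁅⁅c, b⁆, x * a⁆, y⁆ + ⁅⁅⁅y, x⁆, c⁆, a * b⁆ - ⁅⁅⁅a * c, b⁆, x⁆, y⁆
      - ⁅⁅⁅x, b * a⁆, c⁆, y⁆ - ⁅⁅⁅c, y⁆, x * b⁆, a⁆ - ⁅⁅⁅c, x⁆, b⁆, a * y⁆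
      - ⁅⁅⁅y, x * a⁆, b⁆, c⁆ - ⁅⁅⁅y, x⁆, a * b⁆, c⁆ - ⁅⁅⁅b, y⁆, c * a⁆, x⁆
      - ⁅⁅⁅b, a⁆, c⁆, x * y⁆ := by
  simp only [Ring.lie_def, mul_sub, sub_mul, mul_assoc]
  abel

theorem lie_mem_commutatorSpan_of_mem_commutatorIdeal_add_two (h3 : (3 : K) ≠ 0) {n : ℕ}
    (ih : ∀ m ∈ commutatorIdeal K A n, ∀ y : A, ⁅m, y⁆ ∈ commutatorSpan K A (n + 1))
    {m : A} (hm : m ∈ commutatorIdeal K A (n + 2)) (y : A) :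
    ⁅m, y⁆ ∈ commutatorSpan K A (n + 3) := by
  have key : ∀ a ∈ commutatorSpan K A n, ∀ b c x : A,
      ⁅x * ⁅⁅a, b⁆, c⁆, y⁆ ∈ commutatorSpan K A (n + 3) := by
    intro a ha b c x
    have q : ∀ z ∈ commutatorIdeal K A n, ∀ k, ∀ w ∈ commutatorSpan K A k,
        ⁅w, z⁆ ∈ commutatorSpan K A (n + k + 1) := fun z hz k w hw => by
      rw [← lie_skew]
      exact neg_mem (lie_mem_commutatorSpan_add_of_forall (ih z hz) k w hw)
    -- `p0` to `p3` treat the four positions of the entry from the ideal.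
    have p0 : ∀ z ∈ commutatorIdeal K A n, ∀ u v w : A,
        ⁅⁅⁅z, u⁆, v⁆, w⁆ ∈ commutatorSpan K A (n + 3) := fun z hz u v w =>
      lie_mem_commutatorSpan (lie_mem_commutatorSpan (ih z hz u) v) w
    have p1 : ∀ z ∈ commutatorIdeal K A n, ∀ u v w : A,
        ⁅⁅⁅u, z⁆, v⁆, w⁆ ∈ commutatorSpan K A (n + 3) := fun z hz u v w =>
      lie_mem_commutatorSpan (lie_mem_commutatorSpan (q z hz 0 u (mem_commutatorSpan_zero _)) v) w
    have p2 : ∀ z ∈ commutatorIdeal K A n, ∀ u v w : A,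
        ⁅⁅⁅u, v⁆, z⁆, w⁆ ∈ commutatorSpan K A (n + 3) := fun z hz u v w =>
      lie_mem_commutatorSpan (q z hz 1 _ (lie_mem_commutatorSpan (mem_commutatorSpan_zero _) v)) w
    have p3 : ∀ z ∈ commutatorIdeal K A n, ∀ u v w : A,
        ⁅⁅⁅u, v⁆, w⁆, z⁆ ∈ commutatorSpan K A (n + 3) := fun z hz u v w =>
      q z hz 2 _ (lie_mem_commutatorSpan (lie_mem_commutatorSpan (mem_commutatorSpan_zero _) v) w)
    have hz := commutatorSpan_le_commutatorIdeal n ha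
    have hr := mul_right_mem_commutatorIdeal ha
    have hl := mul_left_mem_commutatorIdeal ha
    have h : (3 : K) • ⁅x * ⁅⁅a, b⁆, c⁆, y⁆ ∈ commutatorSpan K A (n + 3) := by
      rw [ofNat_smul_eq_nsmul K 3, three_nsmul_lie_mul_lie_lie]
      refine sub_mem (sub_mem (sub_mem (sub_mem (sub_mem (sub_mem (sub_mem (sub_mem
        (add_mem (add_mem (add_mem (add_mem (add_mem (add_mem (add_mem (add_mem (add_mem (add_mem
        (nsmul_mem ?_ 2) ?_) ?_) ?_) ?_) ?_) ?_) ?_) ?_) ?_) ?_) ?_) ?_) ?_) ?_) ?_) ?_) ?_) ?_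
      · exact p0 _ hz _ _ _
      · exact p2 _ hz _ _ _
      · exact p1 _ hz _ _ _
      · exact p2 _ hz _ _ _
      · exact p3 _ (hr _) _ _ _
      · exact p3 _ hz _ _ _
      · exact p3 _ (hr _) _ _ _
      · exact p2 _ hz _ _ _
      · exact p1 _ hz _ _ _
      · exact p2 _ (hl _) _ _ _
      · exact p3 _ (hr _) _ _ _
      · exact p0 _ (hr _) _ _ _
      · exact p1 _ (hl _) _ _ _
      · exact p3 _ hz _ _ _
      · exact p3 _ (hr _) _ _ _
      · exact p1 _ (hl _) _ _ _
      · exact p2 _ (hr _) _ _ _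
      · exact p2 _ (hl _) _ _ _
      · exact p1 _ hz _ _ _
    exact (Submodule.smul_mem_iff _ h3).1 h
  have hspan : ∀ x : A, ∀ d ∈ commutatorSpan K A (n + 2),
      ⁅x * d, y⁆ ∈ commutatorSpan K A (n + 3) := by
    intro x d hd
    suffices commutatorSpan K A (n + 2) ≤
        (commutatorSpan K A (n + 3)).comap (commutatorRight K y ∘ₗ LinearMap.mulLeft K x) from this hd
    refine commutatorSpan_succ_induction fun d hd c => ?_
    suffices commutatorSpan K A (n + 1) ≤ (commutatorSpan K A (n + 3)).comap
        (commutatorRight K y ∘ₗ LinearMap.mulLeft K x ∘ₗ commutatorRight K c) from this hd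
    exact commutatorSpan_succ_induction fun a ha b => key a ha b c x
  suffices commutatorIdeal K A (n + 2) ≤
      (commutatorSpan K A (n + 3)).comap (commutatorRight K y) from this hm
  refine Submodule.span_le.2 ?_
  rintro _ ⟨x, d, hd, rfl⟩
  exact hspan x d hd

/-- The induction starts at `n = 0`, where the claim is trivial, and moves by two; hence the parity.
-/
theorem lie_mem_commutatorSpan_of_mem_commutatorIdeal (h3 : (3 : K) ≠ 0) {n : ℕ} (hn : Even n) :
    ∀ m ∈ commutatorIdeal K A n, ∀ y : A, ⁅m, y⁆ ∈ commutatorSpan K A (n + 1) := by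
  obtain ⟨r, rfl⟩ := hn
  induction r with
  | zero => exact fun m _ y => lie_mem_commutatorSpan (n := 0) (mem_commutatorSpan_zero _) y
  | succ r ih =>
    rw [show r + 1 + (r + 1) = r + r + 2 by ring]
    exact fun m hm y => lie_mem_commutatorSpan_of_mem_commutatorIdeal_add_two h3 ih hm y

theorem lie_mem_commutatorSpan_add_of_mem_commutatorIdeal (h3 : (3 : K) ≠ 0) {n k : ℕ}
    (hn : Even n) {m w : A} (hm : m ∈ commutatorIdeal K A n) (hw : w ∈ commutatorSpan K A k) :
    ⁅m, w⁆ ∈ commutatorSpan K A (n + k + 1) :=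
  lie_mem_commutatorSpan_add_of_forall
    (lie_mem_commutatorSpan_of_mem_commutatorIdeal h3 hn m hm) k w hw

/-- The product of commutators of lengths `n + 1` and `k + 1`, with `n + 1` odd, lies in the ideal
generated by the commutators of length `n + k + 1`. -/
theorem mul_mem_commutatorIdeal_of_even_left (h3 : (3 : K) ≠ 0) {n k : ℕ} (hn : Even n) {a b : A}
    (ha : a ∈ commutatorSpan K A n) (hb : b ∈ commutatorSpan K A k) :
    a * b ∈ commutatorIdeal K A (n + k) := by
  cases k with
  | zero => exact mul_right_mem_commutatorIdeal ha b
  | succ k =>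
    refine commutatorSpan_succ_induction
      (P := (commutatorIdeal K A (n + (k + 1))).comap (LinearMap.mulLeft K a)) ?_ hb
    intro w hw y
    change a * ⁅w, y⁆ ∈ commutatorIdeal K A _
    -- The product is traded for brackets: `ay` lies in the ideal of `a`, so bracketing it with `w`
    -- gives a genuine commutator sum.
    have e : a * ⁅w, y⁆ = ⁅a, w⁆ * y - ⁅a * y, w⁆ := by simp only [Ring.lie_def]; noncomm_ring
    rw [e]
    exact sub_mem (mul_right_mem_commutatorIdeal (lie_mem_commutatorSpan_add k ha hw) y)
      (commutatorSpan_le_commutatorIdeal _ (lie_mem_commutatorSpan_add_of_mem_commutatorIdeal h3 hn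
        (mul_right_mem_commutatorIdeal ha y) hw))

theorem mul_mem_commutatorIdeal_of_even_right (h3 : (3 : K) ≠ 0) {n k : ℕ} (hn : Even n) {a b : A}
    (ha : a ∈ commutatorSpan K A n) (hb : b ∈ commutatorSpan K A k) :
    b * a ∈ commutatorIdeal K A (n + k) := by
  cases k with
  | zero => exact mul_left_mem_commutatorIdeal ha b
  | succ k =>
    refine commutatorSpan_succ_induction
      (P := (commutatorIdeal K A (n + (k + 1))).comap (LinearMap.mulRight K a)) ?_ hb
    intro w hw y
    change ⁅w, y⁆ * a ∈ commutatorIdeal K A _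
    have e : ⁅w, y⁆ * a = y * ⁅a, w⁆ - ⁅y * a, w⁆ := by simp only [Ring.lie_def]; noncomm_ring
    rw [e]
    exact sub_mem (mul_left_mem_commutatorIdeal (lie_mem_commutatorSpan_add k ha hw) y)
      (commutatorSpan_le_commutatorIdeal _ (lie_mem_commutatorSpan_add_of_mem_commutatorIdeal h3 hn
        (mul_left_mem_commutatorIdeal ha y) hw))

theorem commutatorIdeal_eq_bot {n : ℕ} (h : commutatorSpan K A n = ⊥) :
    commutatorIdeal K A n = ⊥ := by
  rw [eq_bot_iff, commutatorIdeal, Submodule.span_le]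
  rintro _ ⟨x, a, ha, rfl⟩
  rw [h, Submodule.mem_bot] at ha
  simp [ha]

theorem mul_eq_zero_of_commutatorSpan_eq_bot (h3 : (3 : K) ≠ 0) {n i j : ℕ}
    (h : commutatorSpan K A n = ⊥) (hn : Odd n) (hij : i + j = n) {a b : A}
    (ha : a ∈ commutatorSpan K A i) (hb : b ∈ commutatorSpan K A j) : a * b = 0 := by
  rw [← Submodule.mem_bot K, ← commutatorIdeal_eq_bot h, ← hij]
  rcases Nat.even_or_odd i with hi | hi
  · exact mul_mem_commutatorIdeal_of_even_left h3 hi ha hb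
  · rw [add_comm]
    refine mul_mem_commutatorIdeal_of_even_right h3 ?_ hb ha
    rw [← hij, Nat.odd_add] at hn
    exact hn.1 hi

end LowerCentral

/-! ### From polynomial identities to commutator spans -/

section LongCommutator

theorem longCommutator_succ {R : Type*} [Ring R] (u : ℕ → R) (n : ℕ) :
    longCommutator u (n + 2) = ⁅longCommutator u (n + 1), u (n + 2)⁆ := rfl

theorem longCommutator_congr {R : Type*} [Ring R] {u v : ℕ → R} {n : ℕ}
    (h : ∀ i ≤ n + 1, u i = v i) : longCommutator u (n + 1) = longCommutator v (n + 1) := by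
  induction n with
  | zero => exact h 1 le_rfl
  | succ n ih =>
    rw [longCommutator_succ, longCommutator_succ, ih fun i hi => h i (by omega), h _ le_rfl]

theorem map_longCommutator {R S : Type*} [Ring R] [Ring S] (f : R →+* S) (u : ℕ → R) (n : ℕ) :
    f (longCommutator u (n + 1)) = longCommutator (fun i => f (u i)) (n + 1) := by
  induction n with
  | zero => rfl
  | succ n ih => simp only [longCommutator_succ, Ring.lie_def, map_sub, map_mul, ih]

theorem satisfiesIdentity_longCommutator_iff {K : Type*} [Field K] {A : Type*} [Ring A]
    [Algebra K A] {n : ℕ} :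
    SatisfiesIdentity K A (longCommutator (FreeAlgebra.ι K) (n + 1)) ↔
      ∀ a : ℕ → A, longCommutator a (n + 1) = 0 := by
  refine forall_congr' fun a => ?_
  have := map_longCommutator (FreeAlgebra.lift K a).toRingHom (FreeAlgebra.ι K) n
  simp only [AlgHom.toRingHom_eq_coe, RingHom.coe_coe, FreeAlgebra.lift_ι_apply] at this
  rw [this]

theorem commutatorSpan_le_span_longCommutator (K : Type*) [Field K] (A : Type*) [Ring A]
    [Algebra K A] (n : ℕ) :
    commutatorSpan K A n ≤ Submodule.span K (Set.range fun u : ℕ → A => longCommutator u (n + 1)) := by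
  induction n with
  | zero => exact fun a _ => Submodule.subset_span ⟨fun _ => a, rfl⟩
  | succ n ih =>
    refine commutatorSpan_succ_induction fun a ha x => ?_
    suffices Submodule.span K (Set.range fun u : ℕ → A => longCommutator u (n + 1)) ≤
        (Submodule.span K (Set.range fun u : ℕ → A => longCommutator u (n + 2))).comap
          (commutatorRight K x) from this (ih ha)
    refine Submodule.span_le.2 ?_
    rintro _ ⟨u, rfl⟩
    -- Entry `n + 2` is free: the shorter commutator does not use it.
    refine Submodule.subset_span ⟨Function.update u (n + 2) x, ?_⟩
    rw [commutatorRight_apply]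
    dsimp only
    rw [longCommutator_succ, Function.update_self]
    congr 1
    exact longCommutator_congr fun i hi => Function.update_of_ne (by omega) _ _

theorem commutatorSpan_eq_bot {K : Type*} [Field K] {A : Type*} [Ring A] [Algebra K A] {n : ℕ}
    (h : ∀ a : ℕ → A, longCommutator a (n + 1) = 0) : commutatorSpan K A n = ⊥ := by
  rw [eq_bot_iff]
  refine (commutatorSpan_le_span_longCommutator K A n).trans (Submodule.span_le.2 ?_)
  rintro _ ⟨u, rfl⟩
  exact h u

end LongCommutator

/-! ### Commutators in the tensor product -/

section TensorProduct

variable (K : Type*) [Field K] (G : Type*) [Ring G] [Algebra K G] (H : Type*) [Ring H] [Algebra K H]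

/-- The span of the tensors `a ⊗ h` with `a` a commutator of length `n + 1`, and of the tensors
`a b ⊗ [h₁, h₂] h₃` with `a` and `b` commutators of total length `n + 1`. -/
def tensorFiltration (n : ℕ) : Submodule K (G ⊗[K] H) :=
  Submodule.span K ({z | ∃ a ∈ commutatorSpan K G n, ∃ h : H, z = a ⊗ₜ h} ∪
    {z | ∃ i j, i + j + 1 = n ∧ ∃ a ∈ commutatorSpan K G i, ∃ b ∈ commutatorSpan K G j,
      ∃ h₁ h₂ h₃ : H, z = (a * b) ⊗ₜ (⁅h₁, h₂⁆ * h₃)})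

variable {K G H}

theorem tmul_mem_tensorFiltration {n : ℕ} {a : G} (ha : a ∈ commutatorSpan K G n) (h : H) :
    a ⊗ₜ[K] h ∈ tensorFiltration K G H n :=
  Submodule.subset_span (Or.inl ⟨a, ha, h, rfl⟩)

theorem mul_tmul_mem_tensorFiltration {n i j : ℕ} (hij : i + j + 1 = n) {a b : G}
    (ha : a ∈ commutatorSpan K G i) (hb : b ∈ commutatorSpan K G j) (h₁ h₂ h₃ : H) :
    (a * b) ⊗ₜ[K] (⁅h₁, h₂⁆ * h₃) ∈ tensorFiltration K G H n :=
  Submodule.subset_span (Or.inr ⟨i, j, hij, a, ha, b, hb, h₁, h₂, h₃, rfl⟩)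

theorem lie_tmul_tmul (g g' : G) (h h' : H) :
    ⁅g ⊗ₜ[K] h, g' ⊗ₜ[K] h'⁆ = ⁅g, g'⁆ ⊗ₜ (h * h') + (g' * g) ⊗ₜ ⁅h, h'⁆ := by
  simp only [Ring.lie_def, Algebra.TensorProduct.tmul_mul_tmul, TensorProduct.sub_tmul,
    TensorProduct.tmul_sub]
  abel

theorem lie_mem_tensorFiltration (h₁ : ∀ x y z : H, ⁅⁅x, y⁆, z⁆ = 0)
    (h₂ : ∀ x y z w : H, ⁅x, y⁆ * ⁅z, w⁆ = 0) {n : ℕ} {t : G ⊗[K] H}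
    (ht : t ∈ tensorFiltration K G H n) (s : G ⊗[K] H) :
    ⁅t, s⁆ ∈ tensorFiltration K G H (n + 1) := by
  induction s with
  | zero => simp
  | add s s' hs hs' => rw [lie_add]; exact add_mem hs hs'
  | tmul g h =>
    suffices tensorFiltration K G H n ≤
        (tensorFiltration K G H (n + 1)).comap (commutatorRight K (g ⊗ₜ[K] h)) from this ht
    refine Submodule.span_le.2 fun t ht => ?_
    rw [SetLike.mem_coe, Submodule.mem_comap, commutatorRight_apply]
    rcases ht with ⟨a, ha, x, rfl⟩ | ⟨i, j, hij, a, ha, b, hb, x, y, z, rfl⟩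
    · rw [lie_tmul_tmul]
      refine add_mem (tmul_mem_tensorFiltration (lie_mem_commutatorSpan ha g) _) ?_
      -- The term `ga ⊗ [x, h]` is of the second kind, with `g` as a commutator of length 1.
      have := mul_tmul_mem_tensorFiltration (K := K) (i := 0) (j := n) (n := n + 1) (a := g) (by ring)
        (mem_commutatorSpan_zero _) ha x h 1
      rwa [mul_one] at this
    · have hc : ⁅⁅x, y⁆ * z, h⁆ = 0 := by
        have e : ⁅⁅x, y⁆ * z, h⁆ = ⁅x, y⁆ * ⁅z, h⁆ + ⁅⁅x, y⁆, h⁆ * z := by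
          simp only [Ring.lie_def]; noncomm_ring
        rw [e, h₁, h₂, zero_mul, add_zero]
      have e : ⁅a * b, g⁆ = a * ⁅b, g⁆ + ⁅a, g⁆ * b := by
        simp only [Ring.lie_def]; noncomm_ring
      rw [lie_tmul_tmul, hc, TensorProduct.tmul_zero, add_zero, e, TensorProduct.add_tmul, mul_assoc]
      exact add_mem
        (mul_tmul_mem_tensorFiltration (by omega) ha (lie_mem_commutatorSpan hb g) _ _ _)
        (mul_tmul_mem_tensorFiltration (by omega) (lie_mem_commutatorSpan ha g) hb _ _ _)

theorem longCommutator_mem_tensorFiltration (h₁ : ∀ x y z : H, ⁅⁅x, y⁆, z⁆ = 0)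
    (h₂ : ∀ x y z w : H, ⁅x, y⁆ * ⁅z, w⁆ = 0) (u : ℕ → G ⊗[K] H) (n : ℕ) :
    longCommutator u (n + 1) ∈ tensorFiltration K G H n := by
  induction n with
  | zero =>
    change u 1 ∈ _
    induction u 1 with
    | zero => exact zero_mem _
    | add s s' hs hs' => exact add_mem hs hs'
    | tmul g h => exact tmul_mem_tensorFiltration (mem_commutatorSpan_zero _) h
  | succ n ih => exact lie_mem_tensorFiltration h₁ h₂ ih _

theorem tensorFiltration_succ_eq_bot (h3 : (3 : K) ≠ 0) {n : ℕ} (hn : Odd n)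
    (h : commutatorSpan K G n = ⊥) : tensorFiltration K G H (n + 1) = ⊥ := by
  rw [eq_bot_iff, tensorFiltration, Submodule.span_le]
  rintro _ (⟨a, ha, x, rfl⟩ | ⟨i, j, hij, a, ha, b, hb, x, y, z, rfl⟩)
  · have ha' := commutatorSpan_succ_le n ha
    rw [h, Submodule.mem_bot] at ha'
    simp [ha']
  · simp [mul_eq_zero_of_commutatorSpan_eq_bot h3 h hn (by omega) ha hb]

theorem longCommutator_tensorProduct_eq_zero (h3 : (3 : K) ≠ 0)
    (h₁ : ∀ x y z : H, ⁅⁅x, y⁆, z⁆ = 0) (h₂ : ∀ x y z w : H, ⁅x, y⁆ * ⁅z, w⁆ = 0) {n : ℕ}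
    (hn : Odd n) (hG : ∀ a : ℕ → G, longCommutator a (n + 1) = 0) (u : ℕ → G ⊗[K] H) :
    longCommutator u (n + 2) = 0 := by
  have := longCommutator_mem_tensorFiltration h₁ h₂ u (n + 1)
  rwa [tensorFiltration_succ_eq_bot h3 hn (commutatorSpan_eq_bot hG), Submodule.mem_bot] at this

end TensorProduct

end LocalLieRing

theorem proposition2p7 {K : Type*} [Field K] (hK : ringChar K ≠ 3)
    {G : Type*} [Ring G] [Algebra K G] {H : Type*} [Ring H] [Algebra K H]
    (p : ℕ) (hp : 2 ≤ p)
    (hG : SatisfiesIdentity K G (longCommutator (FreeAlgebra.ι K) p))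
    (hH₁ : SatisfiesIdentity K H (longCommutator (FreeAlgebra.ι K) 3))
    (hH₂ : SatisfiesIdentity K H
      (⁅FreeAlgebra.ι K 1, FreeAlgebra.ι K 2⁆ * ⁅FreeAlgebra.ι K 3, FreeAlgebra.ι K 4⁆)) :
    (Even p → SatisfiesIdentity K (G ⊗[K] H) (longCommutator (FreeAlgebra.ι K) (p + 1))) ∧
    (Odd p → SatisfiesIdentity K (G ⊗[K] H) (longCommutator (FreeAlgebra.ι K) (p + 2))) := by
  have h3 : (3 : K) ≠ 0 := fun h => hK <| by
    have hd := ringChar.dvd (R := K) (x := 3) (by exact_mod_cast h)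
    exact ((Nat.dvd_prime Nat.prime_three).1 hd).resolve_left CharP.ringChar_ne_one
  obtain ⟨n, rfl⟩ : ∃ n, p = n + 1 := ⟨p - 1, by omega⟩
  have hG' := satisfiesIdentity_longCommutator_iff.1 hG
  have h₁ : ∀ x y z : H, ⁅⁅x, y⁆, z⁆ = 0 := fun x y z =>
    satisfiesIdentity_longCommutator_iff.1 hH₁ fun i => if i = 1 then x else if i = 2 then y else z
  have h₂ : ∀ x y z w : H, ⁅x, y⁆ * ⁅z, w⁆ = 0 := fun x y z w => by
    simpa [Ring.lie_def] using
      hH₂ fun i => if i = 1 then x else if i = 2 then y else if i = 3 then z else w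
  refine ⟨fun hp' => ?_, fun hp' => ?_⟩
  · exact satisfiesIdentity_longCommutator_iff.2 (longCommutator_tensorProduct_eq_zero h3 h₁ h₂
      (by simpa [Nat.even_add_one] using hp') hG')
  -- For odd `p`, commutators of the even length `p + 1` also vanish in `G`.
  · refine satisfiesIdentity_longCommutator_iff.2 (longCommutator_tensorProduct_eq_zero h3 h₁ h₂
      hp' fun a => ?_)
    simp [longCommutator, hG']
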